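/- Let $G=(V,E)$ be a finite connected simple graph with $m=|V|$ vertices, and let $d(i)$ be the degree of $i\in V$. Fix an orientation of every edge and put $\epsilon_{j,k}=1$ if $j$ is the head of the edge $(j,k)$ and $\epsilon_{j,k}=-1$ if $j$ is its tail. For every vertex $i$ fix a labelling of the neighbours of $i$ (equivalently, of the edges incident to $i$) by $1,\dots,d(i)$; let $<_i$ be the corresponding ordering of the edges incident to $i$. Define edge operators $A_{j,k}$, for adjacent $j,k$, in one of two ways. - *Superfast Encoding.* There is one qubit on each edge, and $$A_{j,k}=\epsilon_{j,k}\,X_{jk}\prod_{p:(j,p)<_j(j,k)}Z_{jp}\prod_{q:(k,q)<_k(k,j)}Z_{kq}.$$ - *Generalized Superfast Encoding (GSE).* Assume that all degrees $d(i)$ are even. There are $d(i)/2$ qubits at each vertex $i$, and for each $i$ one chooses Pauli operators $\gamma_{i,1},\dots,\gamma_{i,d(i)}$ acting only on the qubits at $i$, with $\gamma_{i,p}^\dagger=\gamma_{i,p}$ and $\gamma_{i,p}\gamma_{i,q}+\gamma_{i,q}\gamma_{i,p}=2\delta_{p,q}I$, which together with the phase $iI$ generate the whole Pauli group of the qubits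 at $i$. Put $A_{j,k}=\epsilon_{j,k}\gamma_{j,p}\gamma_{k,q}$, where $k$ is the $p$-th neighbour of $j$ and $j$ is the $q$-th neighbour of $k$. A path $\zeta$ of length $s\ge 0$ is a sequence of vertices $\zeta(0),\dots,\zeta(s)$ with consecutive vertices adjacent (repetitions are allowed); it is a loop if $\zeta(s)=\zeta(0)$. Its path operator is $A(\zeta)=i^{s}A_{\zeta(0),\zeta(1)}\cdots A_{\zeta(s-1),\zeta(s)}$ (the identity if $s=0$). Let $\bar\zeta$ be the reversed path and $\zeta_1\circ\zeta_2$ the concatenation of composable paths. Let $\mathcal S$ be the group generated by the operators $A(\zeta)$ of all loops $\zeta$, and $\mathcal L=\{\psi: A(\zeta)\psi=\psi\text{ for all loops }\zeta\}$ the codespace. Then, for every such choice of either encoding: 1. $A(\bar\zeta)A(\zeta)=I$ for every path $\zeta$. 2. $A(\zeta_1\circ\zeta_2)=A(\zeta_1)A(\zeta_2)$ for all composable paths $\zeta_1,\zeta_2$. 3. If $\zeta$ is a loop, then $A(\zeta)$ commutes with all path operators. 4. If $\zeta$ is a loop, then $A(\zeta)^\dagger=A(\zeta)$. 5. Let $T$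 be any spanning tree of $G$ with any root $r$, let $\omega^v$ be the path in $T$ from $r$ to $v$, and for each edge $e\in E\setminus T$, traversed in either direction as $[j,k]$, let $\zeta^e=\omega^j\circ[j,k]\circ\bar\omega^k$. Then there are $|E\setminus T|=|E|-|V|+1$ such edges, the operators $A(\zeta^e)$ are Hermitian and generate $\mathcal S$, and they are independent: none of them lies in the group generated by the others. 6. $\mathcal S$ is an abelian group of Pauli operators (with phases in $\{\pm1,\pm i\}$) and $-I\notin\mathcal S$. 7. The number of qubits is $n=|E|$, so that the stabilizer code $\mathcal S$ has $n-(|E|-|V|+1)=m-1$ logical qubits, and $\dim\mathcal L=2^{m-1}$. -/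

import Mathlib

/-! ### Qubits and Pauli operators -/

/-- Operators on the Hilbert space `(ℂ²)^{⊗ Q}` of a finite set `Q` of qubits, as matrices in the
computational basis `Q → Fin 2`. -/
abbrev QubitOp (Q : Type*) := Matrix (Q → Fin 2) (Q → Fin 2) ℂ

/-- The labels of the four single-qubit Pauli matrices. -/
inductive Pauli
  | I | X | Y | Z

/-- The single-qubit Pauli matrices. -/
def Pauli.mat : Pauli → Matrix (Fin 2) (Fin 2) ℂ
  | .I => 1
  | .X => !![0, 1; 1, 0]
  | .Y => !![0, -Complex.I; Complex.I, 0]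
  | .Z => !![1, 0; 0, -1]

/-- The tensor product `⊗_q P(q)` of single-qubit Pauli matrices. -/
def pauliString {Q : Type*} [Fintype Q] (P : Q → Pauli) : QubitOp Q :=
  Matrix.of fun x y => ∏ q, (P q).mat (x q) (y q)

open Classical in
/-- The product `∏_{q ∈ F} P_q`, that is, the Pauli matrix `P` on every qubit of `F` and the
identity on the other qubits. -/
noncomputable def pauliOn {Q : Type*} [Fintype Q] (P : Pauli) (F : Set Q) : QubitOp Q :=
  pauliString fun q => if q ∈ F then P else Pauli.I

/-- `M` is an element of the Pauli group (with the phases `±1, ±i`) of the qubits in `F`, tensored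
with the identity on the remaining qubits. -/
def IsPauliOn {Q : Type*} [Fintype Q] (F : Set Q) (M : QubitOp Q) : Prop :=
  ∃ (k : ℕ) (P : Q → Pauli), (∀ q ∉ F, P q = Pauli.I) ∧ M = Complex.I ^ k • pauliString P

/-! ### The data attached to the interaction graph -/

/-- An orientation of every edge of `G` (given by its head), and a labelling of the neighbours of
every vertex `i` (equivalently, of the edges incident to `i`) by `0, …, d(i) - 1`. -/
structure EdgeData {V : Type*} [Fintype V] (G : SimpleGraph V) [DecidableRel G.Adj] where
  head : G.edgeSet → V
  head_mem : ∀ e : G.edgeSet, head e ∈ (e : Sym2 V)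
  label : ∀ i : V, G.neighborSet i ≃ Fin (G.degree i)

namespace EdgeData

variable {V : Type*} [Fintype V] [DecidableEq V] {G : SimpleGraph V} [DecidableRel G.Adj]

/-- `ε_{j,k}`, for the directed edge `d = (j, k)`: `1` if `j` is the head of the edge, and `-1` if
it is the tail. -/
def sign (D : EdgeData G) (d : G.Dart) : ℂ :=
  if D.head ⟨d.edge, d.edge_mem⟩ = d.fst then 1 else -1

/-- For `d = (j, k)`, the label of `k` among the neighbours of `j`. -/
def pos (D : EdgeData G) (d : G.Dart) : Fin (G.degree d.fst) :=
  D.label d.fst ⟨d.snd, d.adj⟩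

/-- For `d = (j, k)`, the edges `(j, p)` that precede `(j, k)` in the ordering of the edges
incident to `j`. -/
def earlier (D : EdgeData G) (d : G.Dart) : Set G.edgeSet :=
  {e | ∃ p : G.neighborSet d.fst, (e : Sym2 V) = s(d.fst, (p : V)) ∧ D.label d.fst p < D.pos d}

end EdgeData

/-- The qubits of a Generalized Superfast Encoding: `d(i) / 2` qubits at every vertex `i`. -/
abbrev VertexQubit {V : Type*} [Fintype V] (G : SimpleGraph V) [DecidableRel G.Adj] :=
  Σ i : V, Fin (G.degree i / 2)

/-- Local Majorana modes `γ_{i,p}`, for `i` a vertex and `p` a label of a neighbour of `i`: Hermitian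
Pauli operators on the qubits located at `i` that obey the Majorana commutation rules and generate,
together with the phase `i`, the full Pauli group of the qubits located at `i`. -/
structure LocalMajoranaModes {V : Type*} [Fintype V] [DecidableEq V] (G : SimpleGraph V)
    [DecidableRel G.Adj] where
  mode : ∀ i : V, Fin (G.degree i) → QubitOp (VertexQubit G)
  isPauliOn : ∀ i p, IsPauliOn {q : VertexQubit G | q.1 = i} (mode i p)
  isHermitian : ∀ i p, (mode i p).IsHermitian
  anticomm : ∀ i p q, mode i p * mode i q + mode i q * mode i p = if p = q then 2 • 1 else 0
  generate : ∀ (i : V) (U : (QubitOp (VertexQubit G))ˣ),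
    IsPauliOn {q : VertexQubit G | q.1 = i} (U : QubitOp (VertexQubit G)) →
    U ∈ Subgroup.closure {W : (QubitOp (VertexQubit G))ˣ |
      (∃ p, (W : QubitOp (VertexQubit G)) = mode i p) ∨
        (W : QubitOp (VertexQubit G)) = Complex.I • (1 : QubitOp (VertexQubit G))}

/-! ### The two encodings -/

/-- The encodings on the graph `G`: the Superfast Encoding, for any choice of edge orientations and
of orderings of the edges incident to every vertex, and, if all the vertices of `G` have even
degree, the Generalized Superfast Encoding, for any choice of edge orientations, of labellings of
the neighbours and of local Majorana modes. -/
inductive Encoding {V : Type*} [Fintype V] [DecidableEq V] (G : SimpleGraph V) [DecidableRel G.Adj]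
  | superfast (D : EdgeData G)
  | generalized (heven : ∀ i, Even (G.degree i)) (D : EdgeData G) (γ : LocalMajoranaModes G)

namespace Encoding

variable {V : Type*} [Fintype V] [DecidableEq V] {G : SimpleGraph V} [DecidableRel G.Adj]

/-- The qubits: one per edge for the Superfast Encoding, and `d(i) / 2` at every vertex `i` for
the generalized one. -/
@[reducible] def Qubit : Encoding G → Type _
  | superfast _ => G.edgeSet
  | generalized _ _ _ => VertexQubit G

instance instFintypeQubit : (𝓔 : Encoding G) → Fintype 𝓔.Qubit
  | superfast _ => inferInstanceAs (Fintype G.edgeSet)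
  | generalized _ _ _ => inferInstanceAs (Fintype (VertexQubit G))

instance instDecidableEqQubit : (𝓔 : Encoding G) → DecidableEq 𝓔.Qubit
  | superfast _ => inferInstanceAs (DecidableEq G.edgeSet)
  | generalized _ _ _ => inferInstanceAs (DecidableEq (VertexQubit G))

/-- The edge operator `A_{j,k}`, for the directed edge `d = (j, k)`:
`ε_{j,k} X_{jk} ∏_{(j,p) <_j (j,k)} Z_{jp} ∏_{(k,q) <_k (k,j)} Z_{kq}` for the Superfast Encoding,
and `ε_{j,k} γ_{j,p} γ_{k,q}`, where `k` is the `p`-th neighbour of `j` and `j` the `q`-th neighbour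
of `k`, for the generalized one. -/
noncomputable def edgeOp : (𝓔 : Encoding G) → G.Dart → QubitOp 𝓔.Qubit
  | superfast D, d =>
      D.sign d • (pauliOn Pauli.X {⟨d.edge, d.edge_mem⟩} * pauliOn Pauli.Z (D.earlier d) *
        pauliOn Pauli.Z (D.earlier d.symm))
  | generalized _ D γ, d =>
      D.sign d • (γ.mode d.fst (D.pos d) * γ.mode d.snd (D.pos d.symm))

/-- The path operator `A(ζ) = i^s A_{ζ(0),ζ(1)} ⋯ A_{ζ(s-1),ζ(s)}` of a path `ζ` of length `s`
(which may intersect itself, so it is a walk). -/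
noncomputable def pathOp (𝓔 : Encoding G) {u v : V} (ζ : G.Walk u v) : QubitOp 𝓔.Qubit :=
  Complex.I ^ ζ.length • (ζ.darts.map 𝓔.edgeOp).prod

/-- The group generated by all the loop operators. -/
noncomputable def loopGroup (𝓔 : Encoding G) : Subgroup (QubitOp 𝓔.Qubit)ˣ :=
  Subgroup.closure {U | ∃ (u : V) (ζ : G.Walk u u), (U : QubitOp 𝓔.Qubit) = 𝓔.pathOp ζ}

/-- The codespace: the states fixed by all the loop operators. -/
noncomputable def codespace (𝓔 : Encoding G) : Submodule ℂ ((𝓔.Qubit → Fin 2) → ℂ) where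
  carrier := {ψ | ∀ (u : V) (ζ : G.Walk u u), (𝓔.pathOp ζ).mulVec ψ = ψ}
  add_mem' := fun {a b} ha hb u ζ => by rw [Matrix.mulVec_add, ha u ζ, hb u ζ]
  zero_mem' := fun _ _ => Matrix.mulVec_zero _
  smul_mem' := fun c a ha u ζ => by rw [Matrix.mulVec_smul, ha u ζ]

end Encoding

/-! ### Fundamental cycles -/

/-- The fundamental cycle `ω^j ∘ [j, k] ∘ (ω^k)⁻¹` of the directed edge `d = (j, k)`, where `ω^v`
is a path from the root `r` to `v` in the spanning subgraph `T`. -/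
def fundamentalLoop {V : Type*} {G T : SimpleGraph V} (hT : T ≤ G) {r : V}
    (ω : ∀ v, T.Walk r v) (d : G.Dart) : G.Walk r r :=
  (((ω d.fst).mapLe hT).append (SimpleGraph.Walk.cons d.adj SimpleGraph.Walk.nil)).append
    ((ω d.snd).mapLe hT).reverse

/-- The generators `g e` are independent: none of them lies in the group generated by the others. -/
def IndependentGenerators {ι H : Type*} [Group H] (g : ι → H) : Prop :=
  ∀ e, g e ∉ Subgroup.closure (g '' {f | f ≠ e})

/-! ### Commutation up to a scalar -/

/-! Both encodings enter only through `EdgeOperatorRelations`: the edge operators are Hermitian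
Pauli involutions, they change sign when the edge is reversed, and two of them anticommute exactly
when their edges share exactly one endpoint. Moreover each edge has a dual, an invertible operator
that anticommutes with the operator of this edge and commutes with all the others.

Past a path operator, the sign acquired by an edge operator telescopes to a contribution of the two
ends of the path (`skewCommute_edgeOp_pathOp`). For a loop these contributions cancel, so loop
operators are central among path operators. The same count shows that loops square to `1`; as
reversal is both inverse and adjoint, loops are Hermitian.

Conjugating by root paths in a spanning tree factors every loop operator into fundamental loops, and
those of tree edges are trivial. The dual of a non-tree edge anticommutes with its own fundamental
loop only, so every nontrivial product of fundamental loops anticommutes with something invertible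
(`exists_dual`, `loopHom_anticommute`). This single fact gives independence, excludes `-I`, and
makes the trace of every nontrivial product vanish. The codespace is the space of invariants of
`(ℤ/2)^(E \ T)`; the trace of the averaging projection leaves only the identity, whence dimension
`2^|E| / 2^(|E| - |V| + 1)`. -/

/-- `M` and `N` commute up to the scalar `c`. -/
def SkewCommute {R : Type*} [Ring R] [Algebra ℂ R] (c : ℂ) (M N : R) : Prop :=
  M * N = c • (N * M)

namespace SkewCommute

variable {R : Type*} [Ring R] [Algebra ℂ R] {c c' : ℂ} {M M' N N' : R}

theorem of_commute (h : Commute M N) : SkewCommute 1 M N := by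
  rw [SkewCommute, one_smul, h.eq]

theorem commute (h : SkewCommute 1 M N) : Commute M N := by
  rw [SkewCommute, one_smul] at h
  exact h

theorem of_eq (h : SkewCommute c M N) (hc : c = c') : SkewCommute c' M N := hc ▸ h

theorem mul_left (h : SkewCommute c M N) (h' : SkewCommute c' M' N) :
    SkewCommute (c * c') (M * M') N := by
  unfold SkewCommute at *
  rw [mul_assoc, h', mul_smul_comm, ← mul_assoc, h, smul_mul_assoc, smul_smul, mul_assoc,
    mul_comm c']

theorem mul_right (h : SkewCommute c M N) (h' : SkewCommute c' M N') :
    SkewCommute (c * c') M (N * N') := by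
  unfold SkewCommute at *
  rw [← mul_assoc, h, smul_mul_assoc, mul_assoc, h', mul_smul_comm, smul_smul, ← mul_assoc]

theorem smul_left (a : ℂ) (h : SkewCommute c M N) : SkewCommute c (a • M) N := by
  unfold SkewCommute at *
  rw [smul_mul_assoc, h, mul_smul_comm, smul_comm]

theorem smul_right (a : ℂ) (h : SkewCommute c M N) : SkewCommute c M (a • N) := by
  unfold SkewCommute at *
  rw [mul_smul_comm, h, smul_mul_assoc, smul_comm]

theorem symm (h : SkewCommute c M N) (hc : c * c' = 1) : SkewCommute c' N M := by
  unfold SkewCommute at *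
  rw [h, smul_smul, mul_comm c', hc, one_smul]

theorem list_prod_right {ι : Type*} {c : ι → ℂ} {f : ι → R} (l : List ι)
    (h : ∀ i ∈ l, SkewCommute (c i) M (f i)) :
    SkewCommute (l.map c).prod M (l.map f).prod := by
  induction l with
  | nil => exact of_commute (Commute.one_right M)
  | cons i l ih =>
    simp only [List.map_cons, List.prod_cons]
    exact (h i (by simp)).mul_right (ih fun j hj => h j (by simp [hj]))

end SkewCommute

/-! ### Tensor products of single-qubit operators -/

section Tensor

variable {Q : Type*} [Fintype Q]

/-- The tensor product of single-qubit operators. -/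
def tensorOp (M : Q → Matrix (Fin 2) (Fin 2) ℂ) : QubitOp Q :=
  Matrix.of fun x y => ∏ q, M q (x q) (y q)

theorem pauliString_eq_tensorOp (P : Q → Pauli) :
    pauliString P = tensorOp fun q => (P q).mat := rfl

/-- By distributivity, the sum over intermediate bit strings of a product over qubits is a product
of single-qubit sums. -/
theorem tensorOp_mul [DecidableEq Q] (M N : Q → Matrix (Fin 2) (Fin 2) ℂ) :
    tensorOp M * tensorOp N = tensorOp fun q => M q * N q := by
  ext x y
  simp only [tensorOp, Matrix.mul_apply, Matrix.of_apply, ← Finset.prod_mul_distrib]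
  rw [Finset.prod_univ_sum]
  simp

theorem tensorOp_smul (c : Q → ℂ) (M : Q → Matrix (Fin 2) (Fin 2) ℂ) :
    (tensorOp fun q => c q • M q) = (∏ q, c q) • tensorOp M := by
  ext x y
  simp [tensorOp, Finset.prod_mul_distrib]

theorem tensorOp_one [DecidableEq Q] : (tensorOp fun _ : Q => 1) = 1 := by
  ext x y
  simp only [tensorOp, Matrix.of_apply, Matrix.one_apply, Finset.prod_ite_zero,
    Finset.prod_const_one, funext_iff, Finset.mem_univ, true_imp_iff]

theorem tensorOp_conjTranspose (M : Q → Matrix (Fin 2) (Fin 2) ℂ) :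
    (tensorOp M).conjTranspose = tensorOp fun q => (M q).conjTranspose := by
  ext x y
  simp [tensorOp, Matrix.conjTranspose_apply]

theorem skewCommute_tensorOp [DecidableEq Q] {c : Q → ℂ} {M N : Q → Matrix (Fin 2) (Fin 2) ℂ}
    (h : ∀ q, SkewCommute (c q) (M q) (N q)) :
    SkewCommute (∏ q, c q) (tensorOp M) (tensorOp N) := by
  unfold SkewCommute at *
  rw [tensorOp_mul, tensorOp_mul, ← tensorOp_smul]
  simp only [h]

end Tensor

/-! ### Pauli strings -/

theorem Pauli.mat_mul_self (P : Pauli) : P.mat * P.mat = 1 := by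
  cases P <;> ext i j <;> fin_cases i <;> fin_cases j <;> simp [Pauli.mat]

theorem Pauli.mat_conjTranspose (P : Pauli) : P.mat.conjTranspose = P.mat := by
  cases P <;> ext i j <;> fin_cases i <;> fin_cases j <;> simp [Pauli.mat]

/-- The product of two single-qubit Pauli matrices, up to a phase. -/
def Pauli.mul : Pauli → Pauli → Pauli
  | .I, P => P
  | P, .I => P
  | .X, .X => .I
  | .Y, .Y => .I
  | .Z, .Z => .I
  | .X, .Y => .Z
  | .Y, .X => .Z
  | .Y, .Z => .X
  | .Z, .Y => .X
  | .Z, .X => .Y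
  | .X, .Z => .Y

theorem Pauli.exists_mat_mul (P P' : Pauli) :
    ∃ k : ℕ, P.mat * P'.mat = Complex.I ^ k • (P.mul P').mat := by
  have h3 : Complex.I ^ 3 = -Complex.I := Complex.I_pow_three
  cases P <;> cases P' <;>
    -- Two single-qubit Paulis multiply with phase `1`, `I` or `-I = I ^ 3`; the phase `-1` never
    -- occurs.
    first
    | (refine ⟨0, ?_⟩
       ext i j
       fin_cases i <;> fin_cases j <;> simp [Pauli.mat, Pauli.mul] <;> done)
    | (refine ⟨1, ?_⟩
       ext i j
       fin_cases i <;> fin_cases j <;> simp [Pauli.mat, Pauli.mul] <;> done)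
    | (refine ⟨3, ?_⟩
       ext i j
       fin_cases i <;> fin_cases j <;> simp [Pauli.mat, Pauli.mul, h3])

theorem Pauli.skewCommute_X_Z : SkewCommute (-1) Pauli.X.mat Pauli.Z.mat := by
  unfold SkewCommute
  ext i j
  fin_cases i <;> fin_cases j <;> simp [Pauli.mat]

section PauliString

variable {Q : Type*} [Fintype Q] [DecidableEq Q]

theorem pauliString_mul_self (P : Q → Pauli) : pauliString P * pauliString P = 1 := by
  rw [pauliString_eq_tensorOp, tensorOp_mul]
  simp only [Pauli.mat_mul_self, tensorOp_one]

omit [DecidableEq Q] in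
theorem pauliString_isHermitian (P : Q → Pauli) : (pauliString P).IsHermitian := by
  rw [Matrix.IsHermitian, pauliString_eq_tensorOp, tensorOp_conjTranspose]
  simp only [Pauli.mat_conjTranspose]

theorem pauliString_commute_of_disjoint {P P' : Q → Pauli}
    (h : ∀ q, P q = Pauli.I ∨ P' q = Pauli.I) : Commute (pauliString P) (pauliString P') := by
  rw [pauliString_eq_tensorOp, pauliString_eq_tensorOp, Commute, SemiconjBy, tensorOp_mul,
    tensorOp_mul]
  congr 1
  funext q
  rcases h q with h | h <;> simp [h, Pauli.mat]

theorem pauliOn_mul_self (P : Pauli) (F : Set Q) : pauliOn P F * pauliOn P F = 1 :=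
  pauliString_mul_self _

omit [DecidableEq Q] in
theorem pauliOn_isHermitian (P : Pauli) (F : Set Q) : (pauliOn P F).IsHermitian :=
  pauliString_isHermitian _

theorem pauliOn_commute (P : Pauli) (F F' : Set Q) : Commute (pauliOn P F) (pauliOn P F') := by
  classical
  rw [pauliOn, pauliOn, pauliString_eq_tensorOp, pauliString_eq_tensorOp, Commute, SemiconjBy,
    tensorOp_mul, tensorOp_mul]
  congr 1
  funext q
  split_ifs <;> simp [Pauli.mat]

open Classical in
theorem skewCommute_pauliOn_X_Z (e : Q) (F : Set Q) :
    SkewCommute (if e ∈ F then -1 else 1) (pauliOn Pauli.X {e}) (pauliOn Pauli.Z F) := by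
  -- The scalar is concentrated on the qubit `e`, the only one where `X` acts.
  have key := skewCommute_tensorOp (c := fun q => if q = e then (if e ∈ F then -1 else 1) else 1)
    (M := fun q => (if q ∈ ({e} : Set Q) then Pauli.X else Pauli.I).mat)
    (N := fun q => (if q ∈ F then Pauli.Z else Pauli.I).mat) fun q => by
      by_cases hq : q = e
      · subst hq
        by_cases hF : q ∈ F
        · simpa [hF] using Pauli.skewCommute_X_Z
        · simpa [hF, Pauli.mat] using SkewCommute.of_commute (Commute.one_right _)
      · simpa [hq, Pauli.mat] using SkewCommute.of_commute (Commute.one_left _)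
  rw [Finset.prod_ite_eq' Finset.univ e, if_pos (Finset.mem_univ e)] at key
  convert key using 1
  · rw [pauliOn, pauliString_eq_tensorOp]
    congr!
  · rfl

theorem IsPauliOn.mul {F : Set Q} {M N : QubitOp Q} (hM : IsPauliOn F M) (hN : IsPauliOn F N) :
    IsPauliOn F (M * N) := by
  obtain ⟨k, P, hP, rfl⟩ := hM
  obtain ⟨k', P', hP', rfl⟩ := hN
  choose s hs using Pauli.exists_mat_mul
  -- The exponent collects the two global phases and one phase from each qubit.
  refine ⟨k + k' + ∑ q, s (P q) (P' q), fun q => (P q).mul (P' q), fun q hq => ?_, ?_⟩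
  · simp only [hP q hq, hP' q hq, Pauli.mul]
  · rw [smul_mul_smul_comm, pauliString_eq_tensorOp, pauliString_eq_tensorOp, tensorOp_mul]
    simp only [hs, tensorOp_smul, smul_smul, Finset.prod_pow_eq_pow_sum]
    rw [pow_add, pow_add]
    rfl

omit [DecidableEq Q] in
theorem IsPauliOn.I_pow_smul {F : Set Q} {M : QubitOp Q} (hM : IsPauliOn F M) (s : ℕ) :
    IsPauliOn F (Complex.I ^ s • M) := by
  obtain ⟨k, P, hP, rfl⟩ := hM
  exact ⟨s + k, P, hP, by rw [smul_smul, pow_add]⟩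

omit [DecidableEq Q] in
theorem IsPauliOn.mono {F F' : Set Q} {M : QubitOp Q} (hM : IsPauliOn F M) (h : F ⊆ F') :
    IsPauliOn F' M := by
  obtain ⟨k, P, hP, rfl⟩ := hM
  exact ⟨k, P, fun q hq => hP q fun hq' => hq (h hq'), rfl⟩

omit [DecidableEq Q] in
theorem isPauliOn_pauliOn (P : Pauli) (F : Set Q) : IsPauliOn F (pauliOn P F) :=
  ⟨0, _, fun q hq => if_neg hq, by rw [pow_zero, one_smul]; rfl⟩

theorem isPauliOn_one (F : Set Q) : IsPauliOn F (1 : QubitOp Q) :=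
  ⟨0, fun _ => Pauli.I, fun _ _ => rfl, by
    rw [pow_zero, one_smul, pauliString_eq_tensorOp, ← tensorOp_one]
    rfl⟩

theorem IsPauliOn.commute_of_disjoint {F F' : Set Q} {M N : QubitOp Q} (hM : IsPauliOn F M)
    (hN : IsPauliOn F' N) (h : Disjoint F F') : Commute M N := by
  obtain ⟨k, P, hP, rfl⟩ := hM
  obtain ⟨k', P', hP', rfl⟩ := hN
  refine ((pauliString_commute_of_disjoint fun q => ?_).smul_left _).smul_right _
  by_cases hq : q ∈ F
  · exact Or.inr (hP' q (Set.disjoint_left.1 h hq))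
  · exact Or.inl (hP q hq)

end PauliString

set_option linter.unusedSectionVars false

/-! ### Commutation signs and the relations shared by the two encodings -/

section EdgeOperators

open Classical

variable {V : Type*} [Fintype V] [DecidableEq V] {G : SimpleGraph V} [DecidableRel G.Adj]

/-- The sign with which the Majorana modes at `d.fst` and `d'.fst`, belonging to the directed
edges `d` and `d'`, commute. -/
noncomputable def modeSign (d d' : G.Dart) : ℂ :=
  if d.fst = d'.fst ∧ d ≠ d' then -1 else 1

/-- The sign with which the edge operator of `d` commutes with a Majorana mode at `v`. -/
noncomputable def vertexSign (d : G.Dart) (v : V) : ℂ :=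
  if v = d.fst ∨ v = d.snd then -1 else 1

theorem dart_symm_fst (d : G.Dart) : d.symm.fst = d.snd := rfl

theorem dart_symm_snd (d : G.Dart) : d.symm.snd = d.fst := rfl

theorem vertexSign_mul_self (d : G.Dart) (v : V) : vertexSign d v * vertexSign d v = 1 := by
  unfold vertexSign
  split_ifs <;> simp

theorem dart_eq_iff (d d' : G.Dart) : d = d' ↔ d.fst = d'.fst ∧ d.snd = d'.snd := by
  rw [SimpleGraph.Dart.ext_iff, Prod.ext_iff]

/-- An edge operator behaves like a product of two modes, one per endpoint, so the commutation of
two edge operators involves four mode signs. One shared endpoint gives a single `-1`; for the same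
edge, in either direction, each mode meets itself and no sign appears, in agreement with `(-1) *
(-1)` on the right. -/
theorem modeSign_prod (d d' : G.Dart) :
    modeSign d d' * modeSign d.symm d' * (modeSign d d'.symm * modeSign d.symm d'.symm) =
      vertexSign d d'.fst * vertexSign d d'.snd := by
  have h1 := d.fst_ne_snd
  have h2 := d'.fst_ne_snd
  simp only [modeSign, vertexSign, ne_eq, dart_eq_iff, dart_symm_fst,
    dart_symm_snd, eq_comm (a := d'.fst), eq_comm (a := d'.snd)]
  by_cases ha : d.fst = d'.fst <;> by_cases hb : d.fst = d'.snd <;>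
    by_cases hc : d.snd = d'.fst <;> by_cases hd : d.snd = d'.snd <;>
    simp only [ha, hb, hc, hd] <;> simp_all

namespace EdgeData

theorem sign_mul_self (D : EdgeData G) (d : G.Dart) : D.sign d * D.sign d = 1 := by
  unfold sign
  split_ifs <;> simp

theorem star_sign (D : EdgeData G) (d : G.Dart) : star (D.sign d) = D.sign d := by
  unfold sign
  split_ifs <;> simp

theorem sign_symm (D : EdgeData G) (d : G.Dart) : D.sign d.symm = -D.sign d := by
  have h := D.head_mem ⟨d.edge, d.edge_mem⟩
  have he : (⟨d.symm.edge, d.symm.edge_mem⟩ : G.edgeSet) = ⟨d.edge, d.edge_mem⟩ :=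
    Subtype.ext d.edge_symm
  have hne := d.fst_ne_snd
  unfold sign
  rw [he, dart_symm_fst]
  generalize D.head ⟨d.edge, d.edge_mem⟩ = w at h
  change w ∈ s(d.fst, d.snd) at h
  rw [Sym2.mem_iff] at h
  rcases h with rfl | rfl
  · simp [hne]
  · simp [hne.symm]

theorem sign_eq (D : EdgeData G) (d : G.Dart) : ∃ k : ℕ, D.sign d = Complex.I ^ k := by
  unfold sign
  split_ifs
  exacts [⟨0, by simp⟩, ⟨2, by simp⟩]

/-- The label of a directed edge, as a natural number. -/
def rank (D : EdgeData G) (d : G.Dart) : ℕ := D.pos d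

theorem rank_injective (D : EdgeData G) {d d' : G.Dart} (h : d.fst = d'.fst)
    (hr : D.rank d = D.rank d') : d = d' := by
  obtain ⟨⟨j, k⟩, a⟩ := d
  obtain ⟨⟨j', k'⟩, a'⟩ := d'
  obtain rfl : j = j' := h
  have := (D.label j).injective (Fin.ext hr)
  obtain rfl : k = k' := congrArg Subtype.val this
  rfl

theorem mem_earlier_iff (D : EdgeData G) (d d' : G.Dart) :
    (⟨d.edge, d.edge_mem⟩ : G.edgeSet) ∈ D.earlier d' ↔
      (d.fst = d'.fst ∧ D.rank d < D.rank d') ∨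
        (d.snd = d'.fst ∧ D.rank d.symm < D.rank d') := by
  obtain ⟨⟨j, k⟩, a⟩ := d
  obtain ⟨⟨j', k'⟩, a'⟩ := d'
  constructor
  · rintro ⟨⟨p, hp⟩, he, hlt⟩
    change s(j, k) = s(j', p) at he
    rcases Sym2.eq_iff.1 he with ⟨rfl, rfl⟩ | ⟨rfl, rfl⟩
    · exact Or.inl ⟨rfl, hlt⟩
    · exact Or.inr ⟨rfl, hlt⟩
  · rintro (⟨h, hlt⟩ | ⟨h, hlt⟩)
    · obtain rfl : j = j' := h
      exact ⟨⟨k, a⟩, rfl, hlt⟩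
    · obtain rfl : k = j' := h
      exact ⟨⟨j, a.symm⟩, Sym2.eq_swap, hlt⟩

/-- The sign with which `X` on the edge of `d` commutes with `Z` on the earlier edges at
`d'.fst`. -/
noncomputable def earlierSign (D : EdgeData G) (d d' : G.Dart) : ℂ :=
  if d.fst = d'.fst ∧ D.rank d < D.rank d' then -1 else 1

/-- The edge of `d` can be incident to `d'.fst` through either endpoint but not through both, so at
most one of the two signs is `-1`. -/
theorem earlierSign_mul_symm (D : EdgeData G) (d d' : G.Dart) :
    D.earlierSign d d' * D.earlierSign d.symm d' =
      if (⟨d.edge, d.edge_mem⟩ : G.edgeSet) ∈ D.earlier d' then -1 else 1 := by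
  have hne := d.fst_ne_snd
  simp only [mem_earlier_iff, earlierSign, dart_symm_fst]
  by_cases h : d.fst = d'.fst
  · have h' : ¬ d.snd = d'.fst := fun h' => hne (h.trans h'.symm)
    simp [h, h']
  · simp only [h, false_and, if_false, one_mul, false_or]
    congr

/-- Of two distinct edges at a vertex exactly one precedes the other. Thus the strings of `Z`
reproduce the signs of Majorana modes, and `modeSign_prod` serves the Superfast Encoding as well. -/
theorem earlierSign_mul_comm (D : EdgeData G) (d d' : G.Dart) :
    D.earlierSign d d' * D.earlierSign d' d = modeSign d d' := by
  unfold earlierSign modeSign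
  by_cases h : d.fst = d'.fst
  · by_cases hd : d = d'
    · subst hd
      simp
    · have hr : D.rank d ≠ D.rank d' := fun hr => hd (D.rank_injective h hr)
      rcases lt_or_gt_of_ne hr with hlt | hlt
      · simp [h, hd, hlt, hlt.not_gt]
      · simp [h, hd, hlt, hlt.not_gt]
  · simp [h, eq_comm (a := d'.fst)]

end EdgeData

/-- The properties of the edge operators on which everything else relies. -/
structure EdgeOperatorRelations {Q : Type*} [Fintype Q] [DecidableEq Q]
    (A : G.Dart → QubitOp Q) : Prop where
  isPauliOn : ∀ d : G.Dart, IsPauliOn Set.univ (A d)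
  isHermitian : ∀ d : G.Dart, (A d).IsHermitian
  mul_self : ∀ d : G.Dart, A d * A d = 1
  symm : ∀ d : G.Dart, A d.symm = -A d
  skewCommute : ∀ d d' : G.Dart, SkewCommute (vertexSign d d'.fst * vertexSign d d'.snd) (A d) (A d')
  dual : ∀ d : G.Dart, ∃ B : QubitOp Q, IsUnit B ∧
    ∀ d' : G.Dart, SkewCommute (if d'.edge = d.edge then -1 else 1) (A d') B

/-! ### The Superfast Encoding -/

section Superfast

variable (D : EdgeData G)

theorem superfast_edgeOp (d : G.Dart) : (Encoding.superfast D).edgeOp d =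
    D.sign d • (pauliOn Pauli.X {⟨d.edge, d.edge_mem⟩} * pauliOn Pauli.Z (D.earlier d) *
        pauliOn Pauli.Z (D.earlier d.symm)) := rfl

theorem skewCommute_X_earlier (d d' : G.Dart) :
    SkewCommute (D.earlierSign d d' * D.earlierSign d.symm d')
      (pauliOn Pauli.X {(⟨d.edge, d.edge_mem⟩ : G.edgeSet)})
      (pauliOn Pauli.Z (D.earlier d')) :=
  (skewCommute_pauliOn_X_Z _ _).of_eq (D.earlierSign_mul_symm d d').symm

theorem earlierSign_mul_self (d d' : G.Dart) : D.earlierSign d d' * D.earlierSign d d' = 1 := by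
  unfold EdgeData.earlierSign
  split_ifs <;> simp

theorem skewCommute_earlier_X (d d' : G.Dart) :
    SkewCommute (D.earlierSign d d' * D.earlierSign d.symm d')
      (pauliOn Pauli.Z (D.earlier d'))
      (pauliOn Pauli.X {(⟨d.edge, d.edge_mem⟩ : G.edgeSet)}) :=
  (skewCommute_X_earlier D d d').symm (by
    linear_combination D.earlierSign d d' ^ 2 * earlierSign_mul_self D d.symm d' +
      earlierSign_mul_self D d d')

/-- An edge does not precede itself at either of its endpoints. -/
theorem commute_X_earlier_self (d d' : G.Dart) (h : d' = d ∨ d' = d.symm) :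
    Commute (pauliOn Pauli.X {(⟨d.edge, d.edge_mem⟩ : G.edgeSet)})
      (pauliOn Pauli.Z (D.earlier d')) := by
  refine ((skewCommute_X_earlier D d d').of_eq ?_).commute
  have h1 := d.fst_ne_snd
  have h2 := d.fst_ne_snd.symm
  unfold EdgeData.earlierSign
  rcases h with rfl | rfl <;> simp [h1, h2]

theorem superfast_relations : EdgeOperatorRelations (Encoding.superfast D).edgeOp := by
  refine ⟨fun d => ?_, fun d => ?_, fun d => ?_, fun d => ?_, fun d d' => ?_, fun d => ?_⟩
  · rw [superfast_edgeOp]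
    obtain ⟨k, hk⟩ := D.sign_eq d
    rw [hk]
    exact ((((isPauliOn_pauliOn _ _).mono (Set.subset_univ _)).mul
      ((isPauliOn_pauliOn _ _).mono (Set.subset_univ _))).mul
      ((isPauliOn_pauliOn _ _).mono (Set.subset_univ _))).I_pow_smul k
  · rw [superfast_edgeOp, Matrix.IsHermitian, Matrix.conjTranspose_smul, D.star_sign,
      Matrix.conjTranspose_mul, Matrix.conjTranspose_mul, (pauliOn_isHermitian _ _).eq,
      (pauliOn_isHermitian _ _).eq, (pauliOn_isHermitian _ _).eq]
    have h1 := commute_X_earlier_self D d d (Or.inl rfl)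
    have h2 := commute_X_earlier_self D d d.symm (Or.inr rfl)
    have h3 := pauliOn_commute Pauli.Z (D.earlier d) (D.earlier d.symm)
    congr 1
    rw [← h1.eq, (h2.symm.mul_right h3.symm).eq]
  · rw [superfast_edgeOp, smul_mul_smul_comm, D.sign_mul_self, one_smul]
    have h1 := commute_X_earlier_self D d d (Or.inl rfl)
    have h2 := commute_X_earlier_self D d d.symm (Or.inr rfl)
    have h3 := pauliOn_commute Pauli.Z (D.earlier d) (D.earlier d.symm)
    rw [(h2.mul_left h3).symm.mul_mul_mul_comm, h1.symm.mul_mul_mul_comm, pauliOn_mul_self,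
      pauliOn_mul_self, pauliOn_mul_self, one_mul, one_mul]
  · rw [superfast_edgeOp, superfast_edgeOp, D.sign_symm, neg_smul, d.symm_symm]
    have he : (⟨d.symm.edge, d.symm.edge_mem⟩ : G.edgeSet) = ⟨d.edge, d.edge_mem⟩ :=
      Subtype.ext d.edge_symm
    rw [he, mul_assoc, (pauliOn_commute Pauli.Z (D.earlier d.symm) (D.earlier d)).eq, ← mul_assoc]
  · rw [superfast_edgeOp, superfast_edgeOp]
    have hZ : ∀ F F' : Set G.edgeSet, SkewCommute 1 (pauliOn Pauli.Z F) (pauliOn Pauli.Z F') :=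
      fun F F' => SkewCommute.of_commute (pauliOn_commute _ _ _)
    have hX := SkewCommute.of_commute (pauliOn_commute Pauli.X
      {(⟨d.edge, d.edge_mem⟩ : G.edgeSet)} {⟨d'.edge, d'.edge_mem⟩})
    have key := ((((hX.mul_right (skewCommute_X_earlier D d d')).mul_right
      (skewCommute_X_earlier D d d'.symm)).mul_left
      (((skewCommute_earlier_X D d' d).mul_right (hZ _ _)).mul_right (hZ _ _))).mul_left
      (((skewCommute_earlier_X D d' d.symm).mul_right (hZ _ _)).mul_right
        (hZ _ _))).smul_left (D.sign d) |>.smul_right (D.sign d')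
    refine key.of_eq ?_
    -- The eight signs between an `X` and a string of `Z` pair up into the four mode signs.
    rw [← modeSign_prod, ← D.earlierSign_mul_comm d d', ← D.earlierSign_mul_comm d.symm d',
      ← D.earlierSign_mul_comm d d'.symm, ← D.earlierSign_mul_comm d.symm d'.symm]
    ring
  -- `Z` on an edge sees only the `X` factor on that edge.
  · refine ⟨pauliOn Pauli.Z {⟨d.edge, d.edge_mem⟩},
      IsUnit.of_mul_eq_one _ (pauliOn_mul_self _ _), fun d' => ?_⟩
    have hZ : ∀ F F' : Set G.edgeSet, SkewCommute 1 (pauliOn Pauli.Z F) (pauliOn Pauli.Z F') :=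
      fun F F' => SkewCommute.of_commute (pauliOn_commute _ _ _)
    rw [superfast_edgeOp]
    refine ((((skewCommute_pauliOn_X_Z _ _).mul_left (hZ _ _)).mul_left
      (hZ _ _)).smul_left _).of_eq ?_
    simp [Subtype.ext_iff]

end Superfast

/-! ### The Generalized Superfast Encoding -/

section Generalized

variable (D : EdgeData G) (γ : LocalMajoranaModes G)

/-- The Majorana mode at `d.fst` that belongs to the directed edge `d`. -/
def LocalMajoranaModes.dartMode (d : G.Dart) : QubitOp (VertexQubit G) := γ.mode d.fst (D.pos d)

theorem LocalMajoranaModes.mode_mul_self (i : V) (p : Fin (G.degree i)) :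
    γ.mode i p * γ.mode i p = 1 := by
  have h := γ.anticomm i p p
  rw [if_pos rfl, ← two_nsmul] at h
  have h2 : (2 : ℂ) • (γ.mode i p * γ.mode i p) = (2 : ℂ) • 1 := by
    simpa only [ofNat_smul_eq_nsmul] using h
  exact smul_right_injective _ (two_ne_zero' ℂ) h2

theorem LocalMajoranaModes.skewCommute_mode (i : V) (p q : Fin (G.degree i)) :
    SkewCommute (if p = q then 1 else -1) (γ.mode i p) (γ.mode i q) := by
  by_cases h : p = q
  · subst h
    simpa using SkewCommute.of_commute (Commute.refl _)
  · have := γ.anticomm i p q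
    rw [if_neg h] at this
    rw [if_neg h, SkewCommute, neg_one_smul]
    exact eq_neg_of_add_eq_zero_left this

theorem LocalMajoranaModes.commute_mode {i j : V} (h : i ≠ j) (p : Fin (G.degree i))
    (q : Fin (G.degree j)) : Commute (γ.mode i p) (γ.mode j q) :=
  (γ.isPauliOn i p).commute_of_disjoint (γ.isPauliOn j q)
    (Set.disjoint_left.2 fun _ hx hy => h (hx.symm.trans hy))

theorem LocalMajoranaModes.skewCommute_dartMode (d d' : G.Dart) :
    SkewCommute (modeSign d d') (γ.dartMode D d) (γ.dartMode D d') := by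
  obtain ⟨⟨j, k⟩, a⟩ := d
  obtain ⟨⟨j', k'⟩, a'⟩ := d'
  by_cases h : j = j'
  · subst h
    refine (γ.skewCommute_mode j _ _).of_eq ?_
    simp [modeSign, EdgeData.pos, dart_eq_iff, ite_not, Subtype.ext_iff]
  · refine (SkewCommute.of_commute (γ.commute_mode h _ _)).of_eq ?_
    simp [modeSign, h]

theorem LocalMajoranaModes.dartMode_mul_self (d : G.Dart) :
    γ.dartMode D d * γ.dartMode D d = 1 := γ.mode_mul_self _ _

theorem LocalMajoranaModes.commute_dartMode_symm (d : G.Dart) :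
    Commute (γ.dartMode D d) (γ.dartMode D d.symm) := γ.commute_mode d.fst_ne_snd _ _

/-- The product of all the Majorana modes at a vertex. -/
noncomputable def LocalMajoranaModes.parity (i : V) : QubitOp (VertexQubit G) :=
  ((List.finRange (G.degree i)).map (γ.mode i)).prod

theorem LocalMajoranaModes.isUnit_parity (i : V) : IsUnit (γ.parity i) := by
  unfold parity
  induction List.finRange (G.degree i) with
  | nil => exact isUnit_one
  | cons p l ih =>
    rw [List.map_cons, List.prod_cons]
    exact (IsUnit.of_mul_eq_one _ (γ.mode_mul_self i p)).mul ih

/-- A mode at `i` commutes with itself and anticommutes with the `d(i) - 1` other modes at `i`, an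
odd number because `d(i)` is even. -/
theorem LocalMajoranaModes.skewCommute_dartMode_parity (heven : ∀ i, Even (G.degree i))
    (d : G.Dart) (i : V) :
    SkewCommute (if d.fst = i then -1 else 1) (γ.dartMode D d) (γ.parity i) := by
  by_cases h : d.fst = i
  · subst h
    rw [if_pos rfl]
    refine (SkewCommute.list_prod_right _ fun q _ =>
      γ.skewCommute_mode d.fst (D.pos d) q).of_eq ?_
    rw [← List.ofFn_eq_map, List.prod_ofFn, ← Finset.mul_prod_erase _ _ (Finset.mem_univ (D.pos d)),
      if_pos rfl, one_mul, Finset.prod_congr rfl (g := fun _ => (-1 : ℂ))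
        (fun q hq => if_neg (Finset.ne_of_mem_erase hq).symm), Finset.prod_const,
      Finset.card_erase_of_mem (Finset.mem_univ _), Finset.card_univ, Fintype.card_fin]
    -- The vertex carries at least one mode, so `degree - 1` is not truncated.
    have hpos : 0 < G.degree d.fst := (D.pos d).pos
    exact Odd.neg_one_pow (Nat.Even.sub_odd hpos (heven _) odd_one)
  · rw [if_neg h]
    refine (SkewCommute.list_prod_right (c := fun _ => 1) _ fun q _ =>
      SkewCommute.of_commute (γ.commute_mode h (D.pos d) q)).of_eq ?_
    simp

variable (heven : ∀ i, Even (G.degree i))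

theorem generalized_edgeOp (d : G.Dart) : (Encoding.generalized heven D γ).edgeOp d =
    D.sign d • (γ.dartMode D d * γ.dartMode D d.symm) := rfl

theorem generalized_relations :
    EdgeOperatorRelations (Encoding.generalized heven D γ).edgeOp := by
  refine ⟨fun d => ?_, fun d => ?_, fun d => ?_, fun d => ?_, fun d d' => ?_, fun d => ?_⟩
  · rw [generalized_edgeOp]
    obtain ⟨k, hk⟩ := D.sign_eq d
    rw [hk]
    exact (((γ.isPauliOn _ _).mono (Set.subset_univ _)).mul
      ((γ.isPauliOn _ _).mono (Set.subset_univ _))).I_pow_smul k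
  · rw [generalized_edgeOp, Matrix.IsHermitian, Matrix.conjTranspose_smul, D.star_sign,
      Matrix.conjTranspose_mul, (γ.commute_dartMode_symm D d).eq]
    congr 2
    exacts [γ.isHermitian _ _, γ.isHermitian _ _]
  · rw [generalized_edgeOp, smul_mul_smul_comm, D.sign_mul_self, one_smul,
      (γ.commute_dartMode_symm D d).symm.mul_mul_mul_comm, γ.dartMode_mul_self,
      γ.dartMode_mul_self, one_mul]
  · rw [generalized_edgeOp, generalized_edgeOp, D.sign_symm, neg_smul, d.symm_symm,
      (γ.commute_dartMode_symm D d).eq]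
  · rw [generalized_edgeOp, generalized_edgeOp]
    have hm := γ.skewCommute_dartMode D
    exact ((((hm d d').mul_left (hm d.symm d')).mul_right
      ((hm d d'.symm).mul_left (hm d.symm d'.symm))).smul_left _).smul_right _ |>.of_eq
      (modeSign_prod d d')
  -- Parity anticommutes with every mode at the vertex, and the mode of `d` anticommutes with all of
  -- these but itself. Their product therefore anticommutes with the mode of `d` alone.
  · refine ⟨γ.dartMode D d * γ.parity d.fst,
      (IsUnit.of_mul_eq_one _ (γ.dartMode_mul_self D d)).mul (γ.isUnit_parity _), fun d' => ?_⟩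
    have hB : ∀ d', SkewCommute (if d' = d then -1 else 1) (γ.dartMode D d')
        (γ.dartMode D d * γ.parity d.fst) := fun d' =>
      ((γ.skewCommute_dartMode D d' d).mul_right
        (γ.skewCommute_dartMode_parity D heven d' d.fst)).of_eq (by
          by_cases h : d' = d
          · simp [h, modeSign]
          · by_cases h' : d'.fst = d.fst <;> simp [h, h', modeSign])
    rw [generalized_edgeOp]
    refine (((hB d').mul_left (hB d'.symm)).smul_left _).of_eq ?_
    simp only [SimpleGraph.dart_edge_eq_iff]
    by_cases h : d' = d
    · subst h
      simp [d'.symm_ne]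
    · have : d'.symm = d ↔ d' = d.symm :=
        ⟨fun h => by rw [← h, d'.symm_symm], fun h => by rw [h, d.symm_symm]⟩
      simp [h, this]

end Generalized

theorem Encoding.relations (𝓔 : Encoding G) : EdgeOperatorRelations 𝓔.edgeOp := by
  cases 𝓔 with
  | superfast D => exact superfast_relations D
  | generalized heven D γ => exact generalized_relations D γ heven

/-- In the generalized case this is the handshake lemma, halving being exact for even degrees. -/
theorem Encoding.card_qubit (𝓔 : Encoding G) : Fintype.card 𝓔.Qubit = G.edgeFinset.card := by
  cases 𝓔 with
  | superfast D => exact (SimpleGraph.edgeFinset_card (G := G)).symm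
  | generalized heven D γ =>
    have h : Fintype.card (VertexQubit G) = ∑ i, G.degree i / 2 := by simp
    have h2 : 2 * ∑ i, G.degree i / 2 = 2 * G.edgeFinset.card := by
      rw [← G.sum_degrees_eq_twice_card_edges, Finset.mul_sum]
      exact Finset.sum_congr rfl fun i _ => Nat.mul_div_cancel' (heven i).two_dvd
    exact h.trans (Nat.eq_of_mul_eq_mul_left two_pos h2)

end EdgeOperators

namespace Encoding

variable {V : Type*} [Fintype V] [DecidableEq V] {G : SimpleGraph V} [DecidableRel G.Adj]
  (𝓔 : Encoding G)

/-! ### Path operators -/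

theorem pathOp_nil (u : V) : 𝓔.pathOp (SimpleGraph.Walk.nil : G.Walk u u) = 1 := by
  simp [pathOp]

theorem pathOp_cons {u v w : V} (h : G.Adj u v) (p : G.Walk v w) :
    𝓔.pathOp (SimpleGraph.Walk.cons h p) =
      (Complex.I • 𝓔.edgeOp ⟨(u, v), h⟩) * 𝓔.pathOp p := by
  simp only [pathOp, SimpleGraph.Walk.length_cons, SimpleGraph.Walk.darts_cons, List.map_cons,
    List.prod_cons, pow_succ', smul_mul_smul_comm]

theorem pathOp_edge {u v : V} (h : G.Adj u v) :
    𝓔.pathOp (SimpleGraph.Walk.cons h SimpleGraph.Walk.nil) =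
      Complex.I • 𝓔.edgeOp ⟨(u, v), h⟩ := by
  rw [pathOp_cons, pathOp_nil, mul_one]

theorem pathOp_append {u v w : V} (p : G.Walk u v) (q : G.Walk v w) :
    𝓔.pathOp (p.append q) = 𝓔.pathOp p * 𝓔.pathOp q := by
  induction p with
  | nil => rw [pathOp_nil, one_mul, SimpleGraph.Walk.nil_append]
  | cons h p ih => rw [SimpleGraph.Walk.cons_append, pathOp_cons, pathOp_cons, ih, mul_assoc]

theorem pathOp_reverse_cons {u v w : V} (h : G.Adj u v) (p : G.Walk v w) :
    𝓔.pathOp (SimpleGraph.Walk.cons h p).reverse =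
      𝓔.pathOp p.reverse * Complex.I • 𝓔.edgeOp ⟨(v, u), h.symm⟩ := by
  rw [SimpleGraph.Walk.reverse_cons, pathOp_append, pathOp_edge]

theorem edgeOp_swap {u v : V} (h : G.Adj u v) :
    𝓔.edgeOp ⟨(v, u), h.symm⟩ = -𝓔.edgeOp ⟨(u, v), h⟩ :=
  𝓔.relations.symm ⟨(u, v), h⟩

/-- Each edge meets its reverse: the sign from reversing it is cancelled by `I * I = -1`. This is
the role of the factor `I ^ s`. -/
theorem pathOp_reverse_mul {u v : V} (p : G.Walk u v) :
    𝓔.pathOp p.reverse * 𝓔.pathOp p = 1 := by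
  induction p with
  | nil => rw [SimpleGraph.Walk.reverse_nil, pathOp_nil, one_mul]
  | cons h p ih =>
    rw [pathOp_reverse_cons, pathOp_cons, mul_assoc, ← mul_assoc (Complex.I • _),
      smul_mul_smul_comm, 𝓔.edgeOp_swap h, neg_mul, 𝓔.relations.mul_self, Complex.I_mul_I, neg_smul_neg,
      one_smul, one_mul, ih]

theorem pathOp_mul_reverse {u v : V} (p : G.Walk u v) :
    𝓔.pathOp p * 𝓔.pathOp p.reverse = 1 := by
  simpa using 𝓔.pathOp_reverse_mul p.reverse

theorem pathOp_reverse {u v : V} (p : G.Walk u v) :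
    𝓔.pathOp p.reverse = (𝓔.pathOp p).conjTranspose := by
  induction p with
  | nil => rw [SimpleGraph.Walk.reverse_nil, pathOp_nil, Matrix.conjTranspose_one]
  | cons h p ih =>
    rw [pathOp_reverse_cons, pathOp_cons, Matrix.conjTranspose_mul, ih, 𝓔.edgeOp_swap h,
      Matrix.conjTranspose_smul, (𝓔.relations.isHermitian _).eq]
    simp

theorem isPauliOn_pathOp {u v : V} (p : G.Walk u v) : IsPauliOn Set.univ (𝓔.pathOp p) := by
  induction p with
  | nil => rw [pathOp_nil]; exact isPauliOn_one _
  | cons h p ih =>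
    rw [pathOp_cons]
    refine IsPauliOn.mul ?_ ih
    simpa using (𝓔.relations.isPauliOn ⟨_, h⟩).I_pow_smul 1

/-- Each interior vertex of the path contributes its sign twice, so only the ends survive. -/
theorem skewCommute_edgeOp_pathOp (d : G.Dart) {u v : V} (p : G.Walk u v) :
    SkewCommute (vertexSign d u * vertexSign d v) (𝓔.edgeOp d) (𝓔.pathOp p) := by
  induction p with
  | nil =>
    rw [pathOp_nil]
    exact (SkewCommute.of_commute (Commute.one_right _)).of_eq (vertexSign_mul_self d _).symm
  | cons h p ih =>
    rw [pathOp_cons]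
    refine (((𝓔.relations.skewCommute d ⟨(_, _), h⟩).smul_right _).mul_right ih).of_eq ?_
    rw [mul_assoc, ← mul_assoc (vertexSign d _) (vertexSign d _) (vertexSign d _),
      vertexSign_mul_self, one_mul]

theorem commute_loop_pathOp {u v w : V} (p : G.Walk u u) (q : G.Walk v w) :
    Commute (𝓔.pathOp p) (𝓔.pathOp q) := by
  induction q with
  | nil => rw [pathOp_nil]; exact Commute.one_right _
  | cons h q ih =>
    rw [pathOp_cons]
    refine Commute.mul_right ?_ ih
    exact (((𝓔.skewCommute_edgeOp_pathOp ⟨(_, _), h⟩ p).of_eq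
      (vertexSign_mul_self _ _)).commute.smul_left _).symm

/-- Only loops matter later, but removing the first edge of a loop leaves an open path, so the
induction needs both cases. -/
theorem pathOp_mul_self {u v : V} (p : G.Walk u v) :
    𝓔.pathOp p * 𝓔.pathOp p = if u = v then 1 else -1 := by
  induction p with
  | nil => rw [pathOp_nil, mul_one, if_pos rfl]
  | @cons u v w h p ih =>
    have hs := 𝓔.skewCommute_edgeOp_pathOp ⟨(u, v), h⟩ p
    have hne : u ≠ v := h.ne
    rw [pathOp_cons, smul_mul_assoc, smul_mul_smul_comm, Complex.I_mul_I]
    -- Swapping in the first factor only brings the two copies of the edge operator together, where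
    -- they cancel.
    nth_rw 1 [hs]
    rw [smul_mul_assoc, ← mul_assoc, mul_assoc (𝓔.pathOp p) (𝓔.edgeOp _) (𝓔.edgeOp _),
      𝓔.relations.mul_self, mul_one, ih, smul_smul]
    by_cases h1 : v = w
    · subst h1
      rw [vertexSign_mul_self]
      simp [hne]
    · by_cases h2 : u = w
      · subst h2
        simp [vertexSign, h1]
      · simp [vertexSign, h1, h2, Ne.symm h1, Ne.symm h2]

theorem loop_mul_self {u : V} (p : G.Walk u u) : 𝓔.pathOp p * 𝓔.pathOp p = 1 := by
  rw [pathOp_mul_self, if_pos rfl]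

theorem loop_reverse {u : V} (p : G.Walk u u) : 𝓔.pathOp p.reverse = 𝓔.pathOp p := by
  rw [← mul_one (𝓔.pathOp p.reverse), ← 𝓔.loop_mul_self p, ← mul_assoc, pathOp_reverse_mul,
    one_mul]

theorem loop_isHermitian {u : V} (p : G.Walk u u) : (𝓔.pathOp p).IsHermitian := by
  rw [Matrix.IsHermitian, ← pathOp_reverse, loop_reverse]

/-- The path operator as a unit. -/
noncomputable def pathUnit {u v : V} (p : G.Walk u v) : (QubitOp 𝓔.Qubit)ˣ where
  val := 𝓔.pathOp p
  inv := 𝓔.pathOp p.reverse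
  val_inv := 𝓔.pathOp_mul_reverse p
  inv_val := 𝓔.pathOp_reverse_mul p

theorem val_pathUnit {u v : V} (p : G.Walk u v) :
    (𝓔.pathUnit p : QubitOp 𝓔.Qubit) = 𝓔.pathOp p := rfl

theorem pathUnit_append {u v w : V} (p : G.Walk u v) (q : G.Walk v w) :
    𝓔.pathUnit (p.append q) = 𝓔.pathUnit p * 𝓔.pathUnit q :=
  Units.ext (𝓔.pathOp_append p q)

theorem pathUnit_reverse {u v : V} (p : G.Walk u v) :
    𝓔.pathUnit p.reverse = (𝓔.pathUnit p)⁻¹ := Units.ext rfl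

theorem pathUnit_cons {u v w : V} (h : G.Adj u v) (p : G.Walk v w) :
    𝓔.pathUnit (SimpleGraph.Walk.cons h p) =
      𝓔.pathUnit (SimpleGraph.Walk.cons h SimpleGraph.Walk.nil) * 𝓔.pathUnit p := by
  rw [← pathUnit_append, SimpleGraph.Walk.cons_append, SimpleGraph.Walk.nil_append]

theorem commute_loop_pathUnit {u v w : V} (p : G.Walk u u) (q : G.Walk v w) :
    Commute (𝓔.pathUnit p) (𝓔.pathUnit q) :=
  Units.ext (𝓔.commute_loop_pathOp p q)

theorem loop_pathUnit_mul_self {u : V} (p : G.Walk u u) : 𝓔.pathUnit p * 𝓔.pathUnit p = 1 :=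
  Units.ext (𝓔.loop_mul_self p)

theorem pathUnit_mem_loopGroup {u : V} (p : G.Walk u u) : 𝓔.pathUnit p ∈ 𝓔.loopGroup :=
  Subgroup.subset_closure ⟨u, p, rfl⟩

theorem commute_of_mem_loopGroup {U W : (QubitOp 𝓔.Qubit)ˣ} (hU : U ∈ 𝓔.loopGroup)
    (hW : W ∈ 𝓔.loopGroup) : Commute U W := by
  refine Subgroup.closure_induction₂ (p := fun U W _ _ => Commute U W) ?_ ?_ ?_ ?_ ?_ ?_ ?_ hU hW
  · rintro U W ⟨u, p, hU⟩ ⟨v, q, hW⟩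
    refine Units.ext ?_
    rw [Units.val_mul, Units.val_mul, hU, hW]
    exact 𝓔.commute_loop_pathOp p q
  · exact fun U _ => Commute.one_left U
  · exact fun U _ => Commute.one_right U
  · exact fun _ _ _ _ _ _ h h' => h.mul_left h'
  · exact fun _ _ _ _ _ _ h h' => h.mul_right h'
  · exact fun _ _ _ _ h => h.inv_left
  · exact fun _ _ _ _ h => h.inv_right

theorem isPauliOn_of_mem_loopGroup {U : (QubitOp 𝓔.Qubit)ˣ} (hU : U ∈ 𝓔.loopGroup) :
    IsPauliOn Set.univ (U : QubitOp 𝓔.Qubit) := by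
  induction hU using Subgroup.closure_induction'' with
  | one => exact isPauliOn_one _
  | mem U hU =>
    obtain ⟨u, p, hp⟩ := hU
    rw [hp]
    exact 𝓔.isPauliOn_pathOp p
  | inv_mem U hU =>
    obtain ⟨u, p, hp⟩ := hU
    rw [show U = 𝓔.pathUnit p from Units.ext hp, ← pathUnit_reverse]
    exact 𝓔.isPauliOn_pathOp _
  | mul U W _ _ hU hW => exact hU.mul hW

theorem mem_codespace_iff (ψ : (𝓔.Qubit → Fin 2) → ℂ) :
    ψ ∈ 𝓔.codespace ↔ ∀ U ∈ 𝓔.loopGroup, (U : QubitOp 𝓔.Qubit).mulVec ψ = ψ := by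
  constructor
  · intro h U hU
    induction hU using Subgroup.closure_induction with
    | mem U hU =>
      obtain ⟨u, p, hp⟩ := hU
      rw [hp]
      exact h u p
    | one => exact Matrix.one_mulVec ψ
    | mul U W _ _ hU hW => rw [Units.val_mul, ← Matrix.mulVec_mulVec, hW, hU]
    | inv U _ hU =>
      nth_rw 1 [← hU]
      rw [Matrix.mulVec_mulVec, Units.inv_mul, Matrix.one_mulVec]
  · exact fun h u p => h _ (𝓔.pathUnit_mem_loopGroup p)

/-! ### Fundamental loops -/

section Tree

variable {T : SimpleGraph V} (hT : T ≤ G) {r : V} (ω : ∀ v, T.Walk r v)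

/-- The unit of the path from the root in the tree. -/
noncomputable def rootUnit (v : V) : (QubitOp 𝓔.Qubit)ˣ := 𝓔.pathUnit ((ω v).mapLe hT)

theorem pathUnit_fundamentalLoop (d : G.Dart) : 𝓔.pathUnit (fundamentalLoop hT ω d) =
    𝓔.rootUnit hT ω d.fst * 𝓔.pathUnit (SimpleGraph.Walk.cons d.adj SimpleGraph.Walk.nil) *
      (𝓔.rootUnit hT ω d.snd)⁻¹ := by
  rw [fundamentalLoop, pathUnit_append, pathUnit_append, pathUnit_reverse]
  rfl

/-- Reversing the edge reverses the loop, and a loop operator is its own inverse. Hence the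
direction chosen for each non-tree edge is immaterial. -/
theorem fundamentalLoop_symm (d : G.Dart) :
    𝓔.pathUnit (fundamentalLoop hT ω d.symm) = 𝓔.pathUnit (fundamentalLoop hT ω d) := by
  have h : fundamentalLoop hT ω d.symm = (fundamentalLoop hT ω d).reverse := by
    simp only [fundamentalLoop, SimpleGraph.Walk.reverse_append, SimpleGraph.Walk.reverse_reverse,
      SimpleGraph.Walk.append_assoc]
    rfl
  rw [h]
  exact Units.ext (𝓔.loop_reverse _)

/-- For a tree edge, the root path of one endpoint is that of the other extended by this edge, so
the loop merely retraces itself. -/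
theorem fundamentalLoop_of_adj (hac : T.IsAcyclic) (hω : ∀ v, (ω v).IsPath) {d : G.Dart}
    (hd : T.Adj d.fst d.snd) : 𝓔.pathUnit (fundamentalLoop hT ω d) = 1 := by
  have key : ∀ d : G.Dart, T.Adj d.fst d.snd → d.fst ∈ (ω d.snd).support →
      𝓔.pathUnit (fundamentalLoop hT ω d) = 1 := by
    intro d hd hs
    have h := hac.path_concat (hω d.fst) (hω d.snd) hd hs
    rw [pathUnit_fundamentalLoop, mul_inv_eq_one]
    unfold rootUnit
    rw [h, ← pathUnit_append]
    congr 1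
    simp [SimpleGraph.Walk.concat_eq_append, SimpleGraph.Walk.mapLe]
  by_cases hs : d.fst ∈ (ω d.snd).support
  · exact key d hd hs
  · rw [← fundamentalLoop_symm]
    exact key d.symm hd.symm
      (hac.mem_support_of_ne_mem_support_of_adj_of_isPath (hω d.fst) (hω d.snd) hd hs)

/-- The root paths inserted at interior vertices cancel, so the conjugated walk is the product of
the fundamental loops of its darts. -/
theorem rootUnit_conj_mem {H : Subgroup (QubitOp 𝓔.Qubit)ˣ}
    (hH : ∀ d : G.Dart, 𝓔.pathUnit (fundamentalLoop hT ω d) ∈ H) {u v : V} (p : G.Walk u v) :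
    𝓔.rootUnit hT ω u * 𝓔.pathUnit p * (𝓔.rootUnit hT ω v)⁻¹ ∈ H := by
  induction p with
  | nil =>
    rw [show 𝓔.pathUnit (SimpleGraph.Walk.nil : G.Walk _ _) = 1 from Units.ext (𝓔.pathOp_nil _),
      mul_one, mul_inv_cancel]
    exact H.one_mem
  | @cons u v w h p ih =>
    have := H.mul_mem (hH ⟨(u, v), h⟩) ih
    rw [pathUnit_fundamentalLoop] at this
    rw [pathUnit_cons]
    simpa [mul_assoc] using this

theorem loopGroup_le {H : Subgroup (QubitOp 𝓔.Qubit)ˣ}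
    (hH : ∀ d : G.Dart, 𝓔.pathUnit (fundamentalLoop hT ω d) ∈ H) : 𝓔.loopGroup ≤ H := by
  refine (Subgroup.closure_le _).2 ?_
  rintro U ⟨u, p, hp⟩
  have h := 𝓔.rootUnit_conj_mem hT ω hH p
  -- A loop need not start at the root, but it commutes with the root path, so the conjugation
  -- disappears.
  rw [rootUnit, ← (𝓔.commute_loop_pathUnit p _).eq, mul_inv_cancel_right] at h
  rwa [show U = 𝓔.pathUnit p from Units.ext hp]

variable (δ : ↥(G.edgeSet \ T.edgeSet) → G.Dart)

/-- The loop units of the fundamental cycles. -/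
noncomputable def fundamentalUnit (e : ↥(G.edgeSet \ T.edgeSet)) : (QubitOp 𝓔.Qubit)ˣ :=
  𝓔.pathUnit (fundamentalLoop hT ω (δ e))

theorem closure_fundamentalUnit (hac : T.IsAcyclic) (hω : ∀ v, (ω v).IsPath)
    (hδ : ∀ e, (δ e).edge = e) :
    Subgroup.closure (Set.range (𝓔.fundamentalUnit hT ω δ)) = 𝓔.loopGroup := by
  refine le_antisymm ((Subgroup.closure_le _).2 ?_) (𝓔.loopGroup_le hT ω fun d => ?_)
  · rintro _ ⟨e, rfl⟩
    exact 𝓔.pathUnit_mem_loopGroup _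
  · by_cases hd : T.Adj d.fst d.snd
    · rw [𝓔.fundamentalLoop_of_adj hT ω hac hω hd]
      exact Subgroup.one_mem _
    · have hd' : d.edge ∈ G.edgeSet \ T.edgeSet := ⟨d.edge_mem, hd⟩
      have he := hδ ⟨d.edge, hd'⟩
      have hmem : 𝓔.fundamentalUnit hT ω δ ⟨d.edge, hd'⟩ ∈
          Subgroup.closure (Set.range (𝓔.fundamentalUnit hT ω δ)) :=
        Subgroup.subset_closure ⟨_, rfl⟩
      rcases SimpleGraph.dart_edge_eq_iff _ _ |>.1 he with h | h
      · rwa [fundamentalUnit, h] at hmem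
      · rwa [fundamentalUnit, h, fundamentalLoop_symm] at hmem

theorem commute_pathOp_mapLe {B : QubitOp 𝓔.Qubit}
    (hB : ∀ d : G.Dart, T.Adj d.fst d.snd → Commute (𝓔.edgeOp d) B) {u v : V} (p : T.Walk u v) :
    Commute (𝓔.pathOp (p.mapLe hT)) B := by
  induction p with
  | nil =>
    rw [SimpleGraph.Walk.mapLe, SimpleGraph.Walk.map_nil, pathOp_nil]
    exact Commute.one_left _
  | @cons u v w h p ih =>
    have : (SimpleGraph.Walk.cons h p).mapLe hT = SimpleGraph.Walk.cons (hT h) (p.mapLe hT) := rfl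
    rw [this, pathOp_cons]
    exact ((hB ⟨(u, v), hT h⟩ h).smul_left _).mul_left ih

/-- The dual of a non-tree edge commutes with all tree paths, and each fundamental loop contains
just one non-tree edge. -/
theorem exists_dual (hδ : ∀ e, (δ e).edge = e) (e : ↥(G.edgeSet \ T.edgeSet)) :
    ∃ B : (QubitOp 𝓔.Qubit)ˣ, 𝓔.fundamentalUnit hT ω δ e * B = -(B * 𝓔.fundamentalUnit hT ω δ e) ∧
      ∀ f ≠ e, Commute (𝓔.fundamentalUnit hT ω δ f) B := by
  obtain ⟨B, hu, hB⟩ := 𝓔.relations.dual (δ e)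
  have hT' : ∀ {u v : V} (p : T.Walk u v), Commute (𝓔.pathOp (p.mapLe hT)) B := fun p =>
    𝓔.commute_pathOp_mapLe hT (fun d hd => ((hB d).of_eq (if_neg fun h => by
      rw [hδ] at h
      exact e.2.2 (h ▸ hd))).commute) p
  have key : ∀ f, SkewCommute (if f = e then -1 else 1)
      (𝓔.pathOp (fundamentalLoop hT ω (δ f))) B := by
    intro f
    rw [fundamentalLoop, pathOp_append, pathOp_append, pathOp_edge]
    have h1 := SkewCommute.of_commute (hT' (ω (δ f).fst))
    have h2 := SkewCommute.of_commute (hT' (ω (δ f).snd).reverse)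
    rw [SimpleGraph.Walk.mapLe, ← SimpleGraph.Walk.reverse_map] at h2
    refine ((h1.mul_left ((hB (δ f)).smul_left _)).mul_left h2).of_eq ?_
    simp [hδ, Subtype.ext_iff]
  lift B to (QubitOp 𝓔.Qubit)ˣ using hu
  refine ⟨B, Units.ext ?_, fun f hf => Units.ext ?_⟩
  · simpa [SkewCommute, fundamentalUnit, val_pathUnit] using key e
  · simpa [SkewCommute, fundamentalUnit, val_pathUnit, hf] using key f

end Tree

end Encoding

/-! ### Groups generated by commuting involutions -/

section Involutions

variable {H : Type*} [Group H] {ι : Type*} [Fintype ι]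

/-- The homomorphism from the cyclic group of order two given by an involution. -/
def involutionHom (h : H) (hh : h * h = 1) : Multiplicative (ZMod 2) →* H where
  toFun x := if x = 1 then 1 else h
  map_one' := if_pos rfl
  map_mul' x y := by
    have hz : ∀ x : Multiplicative (ZMod 2), x = 1 ∨ x = Multiplicative.ofAdd 1 := by decide
    have h1 : Multiplicative.ofAdd (1 : ZMod 2) ≠ 1 := by decide
    have h2 : Multiplicative.ofAdd (1 : ZMod 2) * Multiplicative.ofAdd 1 = 1 := by decide
    rcases hz x with rfl | rfl <;> rcases hz y with rfl | rfl <;> simp only [h1, h2, hh, mul_one,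
      one_mul, if_true, if_false]

theorem involutionHom_of_ne {h : H} {hh : h * h = 1} {x : Multiplicative (ZMod 2)} (hx : x ≠ 1) :
    involutionHom h hh x = h := if_neg hx

theorem commute_involutionHom {h k : H} {hh : h * h = 1} (hk : Commute h k)
    (x : Multiplicative (ZMod 2)) : Commute (involutionHom h hh x) k := by
  by_cases hx : x = 1
  · rw [hx, map_one]
    exact Commute.one_left k
  · rwa [involutionHom_of_ne hx]

variable (g : ι → H) (h2 : ∀ i, g i * g i = 1) (hc : ∀ i j, Commute (g i) (g j))

include hc in
theorem pairwise_commute_involutionHom :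
    Pairwise fun i j => ∀ x y, Commute (involutionHom (g i) (h2 i) x)
      (involutionHom (g j) (h2 j) y) := fun i j _ x y =>
  commute_involutionHom (commute_involutionHom (hc j i) y).symm x

/-- The homomorphism from the elementary abelian `2`-group given by commuting involutions. -/
def involutionsHom : (ι → Multiplicative (ZMod 2)) →* H :=
  MonoidHom.noncommPiCoprod (fun i => involutionHom (g i) (h2 i))
    (pairwise_commute_involutionHom g h2 hc)

theorem range_involutionsHom :
    (involutionsHom g h2 hc).range = Subgroup.closure (Set.range g) := by
  classical
  apply le_antisymm
  · rw [involutionsHom, MonoidHom.noncommPiCoprod_range]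
    refine iSup_le fun i => ?_
    rintro _ ⟨x, rfl⟩
    by_cases hx : x = 1
    · rw [hx, map_one]
      exact Subgroup.one_mem _
    · rw [involutionHom_of_ne hx]
      exact Subgroup.subset_closure ⟨i, rfl⟩
  · rw [Subgroup.closure_le]
    rintro _ ⟨i, rfl⟩
    refine ⟨Pi.mulSingle i (Multiplicative.ofAdd 1), ?_⟩
    rw [involutionsHom, MonoidHom.noncommPiCoprod_mulSingle]
    exact involutionHom_of_ne (by decide)

/-- An element that commutes with all the involutions but `g i` and anticommutes with `g i`
anticommutes with every product that involves `g i`. -/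
theorem involutionsHom_mul [HasDistribNeg H] {i : ι} {b : H} (hb : g i * b = -(b * g i))
    (hb' : ∀ j ≠ i, Commute (g j) b) {x : ι → Multiplicative (ZMod 2)} (hx : x i ≠ 1) :
    involutionsHom g h2 hc x * b = -(b * involutionsHom g h2 hc x) := by
  classical
  rw [involutionsHom, MonoidHom.noncommPiCoprod_apply,
    ← Finset.mul_noncommProd_erase _ (Finset.mem_univ i), involutionHom_of_ne hx]
  have hr : Commute b (Finset.noncommProd (Finset.univ.erase i)
      (fun j => involutionHom (g j) (h2 j) (x j)) fun j _ k _ _ =>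
        commute_involutionHom (commute_involutionHom (hc k j) (x k)).symm (x j)) :=
    Finset.noncommProd_commute _ _ _ _ fun j hj =>
      (commute_involutionHom (hb' j (Finset.ne_of_mem_erase hj)) (x j)).symm
  rw [mul_assoc, ← hr.eq, ← mul_assoc, hb, neg_mul, mul_assoc]

end Involutions

/-- The other generators lie in the centralizer of `b`, which does not contain `g i`. -/
theorem independentGenerators_of_dual {ι H : Type*} [Group H] [HasDistribNeg H]
    (hne : (-1 : H) ≠ 1) {g : ι → H}
    (hg : ∀ i, ∃ b : H, g i * b = -(b * g i) ∧ ∀ j ≠ i, Commute (g j) b) :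
    IndependentGenerators g := by
  intro i hi
  obtain ⟨b, hb, hb'⟩ := hg i
  have hle : Subgroup.closure (g '' {f | f ≠ i}) ≤ Subgroup.centralizer {b} := by
    rw [Subgroup.closure_le]
    rintro _ ⟨j, hj, rfl⟩
    exact Subgroup.mem_centralizer_singleton_iff.2 (hb' j hj).eq
  have h := Subgroup.mem_centralizer_singleton_iff.1 (hle hi)
  rw [hb] at h
  refine hne (mul_right_cancel (b := b * g i) ?_)
  rw [neg_mul, one_mul, h]

/-! ### The dimension of the codespace -/

/-- `U` is conjugate to `-U` by `B`, and the trace is invariant under conjugation. -/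
theorem Matrix.trace_eq_zero_of_anticommute {n : Type*} [Fintype n] [DecidableEq n]
    {U B : (Matrix n n ℂ)ˣ} (h : U * B = -(B * U)) : (U : Matrix n n ℂ).trace = 0 := by
  have h' : (U : Matrix n n ℂ) = -(B * U * (B⁻¹ : (Matrix n n ℂ)ˣ)) := by
    have := congrArg (fun W : (Matrix n n ℂ)ˣ => ((W * B⁻¹ : (Matrix n n ℂ)ˣ) : Matrix n n ℂ)) h
    simpa [mul_assoc] using this
  have ht : (U : Matrix n n ℂ).trace = -(U : Matrix n n ℂ).trace := by
    conv_lhs => rw [h', Matrix.trace_neg, Matrix.trace_mul_comm, ← mul_assoc, Units.inv_mul,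
      one_mul]
  exact self_eq_neg.1 ht

/-- The dimension of the invariants is the trace of the averaging projection, to which only the
identity contributes. -/
theorem finrank_invariants_of_trace {Γ W : Type*} [Group Γ] [Fintype Γ] [AddCommGroup W]
    [Module ℂ W] [FiniteDimensional ℂ W] (ρ : Representation ℂ Γ W)
    (h : ∀ x, x ≠ 1 → LinearMap.trace ℂ W (ρ x) = 0) :
    Fintype.card Γ * Module.finrank ℂ ρ.invariants = Module.finrank ℂ W := by
  have hcard : (Fintype.card Γ : ℂ) ≠ 0 := Nat.cast_ne_zero.2 Fintype.card_ne_zero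
  have : Invertible (Fintype.card Γ : ℂ) := invertibleOfNonzero hcard
  have key := ρ.isProj_averageMap.trace
  rw [Representation.averageMap, GroupAlgebra.average, map_smul, map_sum, map_smul, map_sum,
    Fintype.sum_eq_single 1 (fun x hx => by simpa using h x hx)] at key
  simp only [map_one, LinearMap.trace_one, invOf_eq_inv,
    smul_eq_mul] at key
  rw [inv_mul_eq_iff_eq_mul₀ hcard] at key
  exact_mod_cast key.symm

section Codespace

variable {V : Type*} [Fintype V] [DecidableEq V] {G : SimpleGraph V} [DecidableRel G.Adj]
  (𝓔 : Encoding G) {T : SimpleGraph V} (hT : T ≤ G) {r : V} (ω : ∀ v, T.Walk r v)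
  (δ : ↥(G.edgeSet \ T.edgeSet) → G.Dart)

/-- A spanning tree has `|V| - 1` edges; the additive form avoids truncated subtraction. -/
theorem card_edgeSet_diff (hT : T ≤ G) (hTree : T.IsTree) :
    Nat.card ↥(G.edgeSet \ T.edgeSet) + Fintype.card V = G.edgeFinset.card + 1 := by
  classical
  have h1 := hTree.card_edgeFinset
  have h2 : (G.edgeSet \ T.edgeSet).ncard + T.edgeSet.ncard = G.edgeSet.ncard :=
    Set.ncard_sdiff_add_ncard_of_subset (SimpleGraph.edgeSet_mono hT)
  have h3 : T.edgeSet.ncard = T.edgeFinset.card := by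
    rw [← SimpleGraph.coe_edgeFinset, Set.ncard_coe_finset]
  have h4 : G.edgeSet.ncard = G.edgeFinset.card := by
    rw [← SimpleGraph.coe_edgeFinset, Set.ncard_coe_finset]
  change (G.edgeSet \ T.edgeSet).ncard + _ = _
  omega

theorem Encoding.neg_one_ne_one : (-1 : (QubitOp 𝓔.Qubit)ˣ) ≠ 1 := by
  intro h
  have := congrArg (fun U : (QubitOp 𝓔.Qubit)ˣ => (U : QubitOp 𝓔.Qubit) 0 0) h
  norm_num at this

variable (hac : T.IsAcyclic) (hω : ∀ v, (ω v).IsPath) (hδ : ∀ e, (δ e).edge = e)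

/-- The parametrization of the group of loop operators by sets of edges outside the tree. -/
noncomputable def Encoding.loopHom [Fintype ↥(G.edgeSet \ T.edgeSet)] :
    (↥(G.edgeSet \ T.edgeSet) → Multiplicative (ZMod 2)) →* (QubitOp 𝓔.Qubit)ˣ :=
  involutionsHom (𝓔.fundamentalUnit hT ω δ) (fun _ => 𝓔.loop_pathUnit_mul_self _)
    fun _ _ => 𝓔.commute_loop_pathUnit _ _

include hT hac hω hδ in
theorem Encoding.range_loopHom [Fintype ↥(G.edgeSet \ T.edgeSet)] :
    (𝓔.loopHom hT ω δ).range = 𝓔.loopGroup := by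
  rw [← 𝓔.closure_fundamentalUnit hT ω δ hac hω hδ]
  exact range_involutionsHom _ _ _

include hδ in
theorem Encoding.loopHom_anticommute [Fintype ↥(G.edgeSet \ T.edgeSet)]
    {x : ↥(G.edgeSet \ T.edgeSet) → Multiplicative (ZMod 2)} (hx : x ≠ 1) :
    ∃ B : (QubitOp 𝓔.Qubit)ˣ, 𝓔.loopHom hT ω δ x * B = -(B * 𝓔.loopHom hT ω δ x) := by
  obtain ⟨e, he⟩ := Function.ne_iff.1 hx
  obtain ⟨B, hB, hB'⟩ := 𝓔.exists_dual hT ω δ hδ e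
  exact ⟨B, involutionsHom_mul _ _ _ hB hB' he⟩

include hT hac hω hδ in
-- A nontrivial product of fundamental loops anticommutes with an invertible operator, whereas `-1`
-- is central.
theorem Encoding.neg_one_notMem_loopGroup : (-1 : (QubitOp 𝓔.Qubit)ˣ) ∉ 𝓔.loopGroup := by
  classical
  have := Fintype.ofFinite ↥(G.edgeSet \ T.edgeSet)
  rw [← 𝓔.range_loopHom hT ω δ hac hω hδ]
  rintro ⟨x, hx⟩
  by_cases hx1 : x = 1
  · rw [hx1, map_one] at hx
    exact 𝓔.neg_one_ne_one hx.symm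
  · obtain ⟨B, hB⟩ := 𝓔.loopHom_anticommute hT ω δ hδ hx1
    rw [hx, neg_one_mul, mul_neg, mul_one, neg_neg] at hB
    refine 𝓔.neg_one_ne_one (mul_right_cancel (b := B) ?_)
    rw [neg_one_mul, one_mul, hB]

include hT hac hω hδ in
-- Working with the representation of `(ℤ/2)^(E \ T)` rather than with the loop group makes the
-- group order explicit; the vanishing traces replace a separate proof that `loopHom` is injective.
theorem Encoding.finrank_codespace :
    2 ^ Nat.card ↥(G.edgeSet \ T.edgeSet) * Module.finrank ℂ 𝓔.codespace =
      2 ^ Fintype.card 𝓔.Qubit := by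
  classical
  have := Fintype.ofFinite ↥(G.edgeSet \ T.edgeSet)
  let ρ : Representation ℂ (↥(G.edgeSet \ T.edgeSet) → Multiplicative (ZMod 2))
      ((𝓔.Qubit → Fin 2) → ℂ) :=
    ((Matrix.toLinAlgEquiv' : QubitOp 𝓔.Qubit ≃ₐ[ℂ] _) : QubitOp 𝓔.Qubit →* _).comp
      ((Units.coeHom _).comp (𝓔.loopHom hT ω δ))
  have hρ : ∀ x, ρ x = Matrix.toLin' (𝓔.loopHom hT ω δ x : QubitOp 𝓔.Qubit) := fun _ => rfl
  have hinv : ρ.invariants = 𝓔.codespace := by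
    ext ψ
    rw [Representation.mem_invariants, 𝓔.mem_codespace_iff,
      ← 𝓔.range_loopHom hT ω δ hac hω hδ]
    simp only [hρ, Matrix.toLin'_apply, MonoidHom.mem_range, forall_exists_index,
      forall_apply_eq_imp_iff]
  have key := finrank_invariants_of_trace ρ fun x hx => by
    obtain ⟨B, hB⟩ := 𝓔.loopHom_anticommute hT ω δ hδ hx
    rw [hρ, Matrix.trace_toLin'_eq]
    exact Matrix.trace_eq_zero_of_anticommute hB
  rw [hinv] at key
  simpa [Nat.card_eq_fintype_card] using key

end Codespace

/-! ### The stabilizer code of an encoding -/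

theorem mainTheorem3 {V : Type*} [Fintype V] [DecidableEq V] (G : SimpleGraph V)
    [DecidableRel G.Adj] (hG : G.Connected) (𝓔 : Encoding G) :
    -- the path operator of the inverse path is the inverse
    (∀ (u v : V) (ζ : G.Walk u v), 𝓔.pathOp ζ.reverse * 𝓔.pathOp ζ = 1) ∧
    -- multiplicativity under composition
    (∀ (u v w : V) (ζ₁ : G.Walk u v) (ζ₂ : G.Walk v w),
      𝓔.pathOp (ζ₁.append ζ₂) = 𝓔.pathOp ζ₁ * 𝓔.pathOp ζ₂) ∧
    -- loop operators commute with all path operators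
    (∀ (u v w : V) (ζ : G.Walk u u) (η : G.Walk v w), Commute (𝓔.pathOp ζ) (𝓔.pathOp η)) ∧
    -- loop operators are Hermitian
    (∀ (u : V) (ζ : G.Walk u u), (𝓔.pathOp ζ).IsHermitian) ∧
    -- for every spanning tree `T` with root `r`, the fundamental cycles of the edges outside `T`
    -- (traversed in any direction) give `|E| - |V| + 1` independent Hermitian generators
    (∀ (T : SimpleGraph V) (hT : T ≤ G), T.IsTree → ∀ (r : V) (ω : ∀ v, T.Walk r v),
      (∀ v, (ω v).IsPath) →
      ∀ δ : ↥(G.edgeSet \ T.edgeSet) → G.Dart, (∀ e, (δ e).edge = e) →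
        (Nat.card ↥(G.edgeSet \ T.edgeSet) : ℤ) = G.edgeFinset.card - Fintype.card V + 1 ∧
        ∃ g : ↥(G.edgeSet \ T.edgeSet) → (QubitOp 𝓔.Qubit)ˣ,
          (∀ e, (g e : QubitOp 𝓔.Qubit) = 𝓔.pathOp (fundamentalLoop hT ω (δ e))) ∧
          (∀ e, (g e : QubitOp 𝓔.Qubit).IsHermitian) ∧
          IndependentGenerators g ∧
          Subgroup.closure (Set.range g) = 𝓔.loopGroup) ∧
    -- the loop group is an abelian group of Pauli operators without `-I`
    (∀ U ∈ 𝓔.loopGroup, IsPauliOn Set.univ (U : QubitOp 𝓔.Qubit)) ∧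
    (∀ U ∈ 𝓔.loopGroup, ∀ W ∈ 𝓔.loopGroup, U * W = W * U) ∧
    (-1 : (QubitOp 𝓔.Qubit)ˣ) ∉ 𝓔.loopGroup ∧
    -- there are `n = |E|` qubits, so `n - (|E| - |V| + 1) = |V| - 1` of them are logical
    Fintype.card 𝓔.Qubit = G.edgeFinset.card ∧
    (Fintype.card 𝓔.Qubit : ℤ) - (G.edgeFinset.card - Fintype.card V + 1) = Fintype.card V - 1 ∧
    Module.finrank ℂ 𝓔.codespace = 2 ^ (Fintype.card V - 1) := by
  -- The claims about `-I` and the dimension mention no tree, so any spanning tree serves for them.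
  obtain ⟨T, hT, hTree⟩ := hG.exists_isTree_le
  obtain ⟨r⟩ := hG.nonempty
  have hpath : ∀ v, ∃ p : T.Walk r v, p.IsPath := fun v =>
    (hTree.connected r v).exists_isPath
  choose ω hω using hpath
  have hdart : ∀ e : ↥(G.edgeSet \ T.edgeSet), ∃ d : G.Dart, d.edge = e := by
    rintro ⟨e, he⟩
    induction e with
    | h u v => exact ⟨⟨(u, v), he.1⟩, rfl⟩
  choose δ hδ using hdart
  have hn := 𝓔.card_qubit
  refine ⟨fun _ _ => 𝓔.pathOp_reverse_mul, fun _ _ _ => 𝓔.pathOp_append,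
    fun _ _ _ => 𝓔.commute_loop_pathOp, fun _ => 𝓔.loop_isHermitian, ?_,
    fun U => 𝓔.isPauliOn_of_mem_loopGroup,
    fun U hU W hW => (𝓔.commute_of_mem_loopGroup hU hW).eq,
    𝓔.neg_one_notMem_loopGroup hT ω δ hTree.isAcyclic hω hδ, hn, by rw [hn]; ring, ?_⟩
  · intro T hT hTree r ω hω δ hδ
    refine ⟨?_, 𝓔.fundamentalUnit hT ω δ, fun e => rfl, fun e => 𝓔.loop_isHermitian _,
      independentGenerators_of_dual 𝓔.neg_one_ne_one (𝓔.exists_dual hT ω δ hδ),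
      𝓔.closure_fundamentalUnit hT ω δ hTree.isAcyclic hω hδ⟩
    have := card_edgeSet_diff hT hTree
    omega
  · have hcard := card_edgeSet_diff hT hTree
    have hpos : 0 < Fintype.card V := Fintype.card_pos_iff.2 ⟨r⟩
    have hfin := 𝓔.finrank_codespace hT ω δ hTree.isAcyclic hω hδ
    -- The number of qubits splits into independent stabilizers and logical qubits; `hpos` keeps
    -- `|V| - 1` untruncated.
    have hexp : Fintype.card 𝓔.Qubit =
        Nat.card ↥(G.edgeSet \ T.edgeSet) + (Fintype.card V - 1) := by omega
    rw [hexp, pow_add] at hfin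
    exact Nat.eq_of_mul_eq_mul_left (by positivity) hfin
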